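/- Rings are associative with an identity element; a ring is called reduced if $0$ is its only nilpotent element, and $A^*$ denotes the group of units of a ring $A$. Let $G$ be a finite abelian group. Then there is a commutative reduced ring $A$ with $A^*\cong G$ if and only if one of the following holds: (i) $G$ is isomorphic to a finite (possibly empty) product $\prod_{i=1}^{n}\mathbb{F}_{q_i}^*$ of multiplicative groups of finite fields; (ii) $G$ is isomorphic to a group of the form $$\prod_{i=1}^{n}\mathbb{F}_{q_i}^*\times(\mathbb{Z}/2\mathbb{Z})^a\times(\mathbb{Z}/4\mathbb{Z})^b\times(\mathbb{Z}/3\mathbb{Z})^c$$ where the first factor is a finite (possibly empty) product of multiplicative groups of finite fields and $a,b,c\ge 0$ are integers such that $a+b\ge 1$, and $a\ge 1$ if $c\ge 1$. The same characterization holds for the finite abelian groups $G$ such that $G\cong A^*$ for some reduced ring $A$ that is not required to be commutative. -/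

import Mathlib

universe u v

/-- The additive group `(ℤ/2)^a × (ℤ/4)^b × (ℤ/3)^c`, written multiplicatively. -/
abbrev TwoFourThree (a b c : ℕ) : Type :=
  Multiplicative ((Fin a → ZMod 2) × (Fin b → ZMod 4) × (Fin c → ZMod 3))

/-- `G` is isomorphic to a finite (possibly empty) product of multiplicative groups of finite
fields, or to the direct product of such a product with one group
`(ℤ/2)^a × (ℤ/4)^b × (ℤ/3)^c` where `a + b ≥ 1`, and `a ≥ 1` if `c ≥ 1`.
Every finite field has a copy in `Type`, so the choice of universe for the fields is harmless. -/
def IsReducedUnitForm (G : Type u) [Group G] : Prop :=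
  ∃ (n : ℕ) (F : Fin n → Type) (_ : ∀ i, Field (F i)), (∀ i, Finite (F i)) ∧
    (Nonempty (G ≃* ((i : Fin n) → (F i)ˣ)) ∨
      ∃ a b c : ℕ, 1 ≤ a + b ∧ (1 ≤ c → 1 ≤ a) ∧
        Nonempty (G ≃* ((i : Fin n) → (F i)ˣ) × TwoFourThree a b c))

/-! Form (ii) adds nothing to form (i): the groups of order 2, 3, 4 are the unit groups of the
fields with 3, 4, 5 elements. So the claim is that exactly the finite products of groups F_q^*
occur, and a product of fields realizes each of them.

Conversely, let A be reduced with finite abelian unit group. The subring generated by the units is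
commutative, reduced, finite over ℤ, and has the same units. Its torsion ideal is finite, hence
generated by an idempotent, which splits the ring into a torsion-free factor and a finite reduced
one. The finite factor is a product of fields. In the torsion-free factor units have order dividing
12 (`units_pow_twelve`): otherwise a Bass cyclic unit of infinite order exists. Finally, each n > 1
dividing 12 is one less than a prime power, so groups of exponent dividing 12 have form (i). -/

/-- `G` is isomorphic to a finite product of unit groups of finite fields. -/
def IsProdFiniteFieldUnits (G : Type u) [Group G] : Prop :=
  ∃ (n : ℕ) (F : Fin n → Type) (_ : ∀ i, Field (F i)), (∀ i, Finite (F i)) ∧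
    Nonempty (G ≃* ((i : Fin n) → (F i)ˣ))

/-! ### Products of unit groups of finite fields -/

/-- Products of groups along a bijection of the index types and isomorphisms of the factors. -/
def MulEquiv.piReindex {ι κ : Type*} (e : κ ≃ ι) {M : ι → Type*} {N : κ → Type*}
    [∀ i, Monoid (M i)] [∀ k, Monoid (N k)] (f : ∀ k, M (e k) ≃* N k) :
    (∀ i, M i) ≃* ∀ k, N k :=
  { Equiv.trans (Equiv.piCongrLeft M e).symm (Equiv.piCongrRight fun k => (f k).toEquiv) with
    map_mul' := fun x y => by
      funext k
      simp [Equiv.piCongrLeft_symm_apply] }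

/-- The product over a sum type is the product of the products. -/
def MulEquiv.sumPi {ι κ : Type*} (M : ι ⊕ κ → Type*) [∀ i, Monoid (M i)] :
    (∀ i, M i) ≃* (∀ i, M (Sum.inl i)) × (∀ k, M (Sum.inr k)) :=
  { Equiv.sumPiEquivProdPi M with map_mul' := fun _ _ => rfl }

theorem IsProdFiniteFieldUnits.of_pi {G : Type u} [Group G] {ι : Type*} [Finite ι]
    {F : ι → Type*} [∀ i, Field (F i)] [∀ i, Finite (F i)] (e : G ≃* ∀ i, (F i)ˣ) :
    IsProdFiniteFieldUnits G := by
  obtain ⟨n, ⟨r⟩⟩ := Finite.exists_equiv_fin ι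
  refine ⟨n, fun k => Shrink.{0} (F (r.symm k)), fun k => inferInstance, fun k => inferInstance,
    ⟨e.trans (MulEquiv.piReindex r.symm fun k => Units.mapEquiv ?_)⟩⟩
  exact (Shrink.ringEquiv.{0} (F (r.symm k))).symm.toMulEquiv

theorem IsProdFiniteFieldUnits.of_mulEquiv {G : Type u} {H : Type v} [Group G] [Group H]
    (h : IsProdFiniteFieldUnits G) (e : H ≃* G) : IsProdFiniteFieldUnits H := by
  obtain ⟨n, F, hF, hfin, ⟨f⟩⟩ := h
  exact ⟨n, F, hF, hfin, ⟨e.trans f⟩⟩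

theorem IsProdFiniteFieldUnits.prod {G : Type u} {H : Type v} [Group G] [Group H]
    (hG : IsProdFiniteFieldUnits G) (hH : IsProdFiniteFieldUnits H) :
    IsProdFiniteFieldUnits (G × H) := by
  obtain ⟨n, F, hF, hFfin, ⟨f⟩⟩ := hG
  obtain ⟨m, K, hK, hKfin, ⟨k⟩⟩ := hH
  let : ∀ i, Field (Sum.elim F K i) := fun i => match i with
    | .inl i => hF i
    | .inr i => hK i
  have : ∀ i, Finite (Sum.elim F K i) := fun i => match i with
    | .inl i => hFfin i
    | .inr i => hKfin i
  exact .of_pi ((f.prodCongr k).trans (MulEquiv.sumPi fun i => (Sum.elim F K i)ˣ).symm)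

/-- The orders 2, 3, 4, 6, 12 come from the fields with 3, 4, 5, 7, 13 elements. -/
theorem exists_field_card_eq_succ {n : ℕ} (h1 : 1 < n) (h : n ∣ 12) :
    ∃ (F : Type) (_ : Field F), Finite F ∧ Nat.card F = n + 1 := by
  have hn : IsPrimePow (n + 1) := by
    have hle : n ≤ 12 := Nat.le_of_dvd (by norm_num) h
    rw [isPrimePow_nat_iff]
    interval_cases n
    · exact ⟨3, 1, by norm_num⟩
    · exact ⟨2, 2, by norm_num⟩
    · exact ⟨5, 1, by norm_num⟩
    · omega
    · exact ⟨7, 1, by norm_num⟩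
    all_goals first | omega | exact ⟨13, 1, by norm_num⟩
  obtain ⟨p, k, hp, hk, hpk⟩ := (isPrimePow_nat_iff _).1 hn
  have := Fact.mk hp
  exact ⟨GaloisField p k, inferInstance, inferInstance, by rw [GaloisField.card p k hk.ne', hpk]⟩

theorem IsProdFiniteFieldUnits.of_pow_twelve {G : Type u} [CommGroup G] [Finite G]
    (h : ∀ g : G, g ^ 12 = 1) : IsProdFiniteFieldUnits G := by
  classical
  obtain ⟨ι, _, n, hn, ⟨e⟩⟩ := CommGroup.equiv_prod_multiplicative_zmod_of_finite G
  have hdvd : ∀ i, n i ∣ 12 := by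
    intro i
    have h1 := h (e.symm (Pi.mulSingle i (Multiplicative.ofAdd 1)))
    rw [← map_pow, MulEquiv.map_eq_one_iff, ← Pi.mulSingle_pow, Pi.mulSingle_eq_one_iff,
      ← ofAdd_nsmul, ofAdd_eq_one, nsmul_one] at h1
    exact (ZMod.natCast_eq_zero_iff _ _).1 h1
  choose F hF hfin hcard using fun i => exists_field_card_eq_succ (hn i) (hdvd i)
  refine .of_pi (F := F) (e.trans (MulEquiv.piCongrRight fun i => mulEquivOfCyclicCardEq ?_))
  rw [Nat.card_units, hcard i, Nat.card_congr Multiplicative.toAdd, Nat.card_zmod,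
    Nat.add_sub_cancel]

theorem IsProdFiniteFieldUnits.isReducedUnitForm {G : Type u} [Group G]
    (h : IsProdFiniteFieldUnits G) : IsReducedUnitForm G := by
  obtain ⟨n, F, hF, hfin, e⟩ := h
  exact ⟨n, F, hF, hfin, .inl e⟩

theorem isProdFiniteFieldUnits_twoFourThree (a b c : ℕ) :
    IsProdFiniteFieldUnits (TwoFourThree a b c) := by
  refine .of_pow_twelve fun g => ?_
  apply Multiplicative.toAdd.injective
  rw [toAdd_pow, toAdd_one]
  ext i
  · exact (by decide : ∀ x : ZMod 2, 12 • x = 0) _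
  · exact (by decide : ∀ x : ZMod 4, 12 • x = 0) _
  · exact (by decide : ∀ x : ZMod 3, 12 • x = 0) _

theorem isReducedUnitForm_iff {G : Type u} [Group G] :
    IsReducedUnitForm G ↔ IsProdFiniteFieldUnits G := by
  refine ⟨?_, IsProdFiniteFieldUnits.isReducedUnitForm⟩
  rintro ⟨n, F, hF, hfin, ⟨⟨e⟩⟩ | ⟨a, b, c, -, -, ⟨e⟩⟩⟩
  · exact ⟨n, F, hF, hfin, ⟨e⟩⟩
  · exact (IsProdFiniteFieldUnits.prod ⟨n, F, hF, hfin, ⟨.refl _⟩⟩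
      (isProdFiniteFieldUnits_twoFourThree a b c)).of_mulEquiv e

theorem IsProdFiniteFieldUnits.exists_commRing {G : Type u} [Group G]
    (h : IsProdFiniteFieldUnits G) :
    ∃ (A : Type v) (_ : CommRing A), IsReduced A ∧ Nonempty (Aˣ ≃* G) := by
  obtain ⟨n, F, hF, -, ⟨e⟩⟩ := h
  have r : ULift.{v} (∀ i, F i) ≃+* ∀ i, F i := ULift.ringEquiv
  exact ⟨ULift.{v} (∀ i, F i), inferInstance, isReduced_of_injective r r.injective,
    ⟨((Units.mapEquiv r.toMulEquiv).trans MulEquiv.piUnits).trans e.symm⟩⟩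

theorem isProdFiniteFieldUnits_units_of_finite (R : Type u) [CommRing R] [Finite R]
    [IsReduced R] : IsProdFiniteFieldUnits Rˣ := by
  let : ∀ I : MaximalSpectrum R, Field (R ⧸ I.asIdeal) := fun I => Ideal.Quotient.field _
  have : ∀ I : MaximalSpectrum R, Finite (R ⧸ I.asIdeal) := fun I =>
    Finite.of_surjective _ Ideal.Quotient.mk_surjective
  exact .of_pi ((Units.mapEquiv (IsArtinianRing.equivPi R).toMulEquiv).trans MulEquiv.piUnits)
-- Bass cyclic units and torsion-free rings
open Polynomial

/-- The Bass cyclic unit attached to `k * l = 1 + m`, with its inverse. -/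
theorem bass_cyclic_mul_eq_one {R : Type*} [CommRing R] {v : R} {m k l a c d : ℕ} (hm : 0 < m)
    (hv : v ^ m = 1) (hkl : k * l = 1 + m) (hc : k ^ a = 1 + m * c) (hd : l ^ a = 1 + m * d) :
    ((∑ i ∈ Finset.range k, v ^ i) ^ a - c * ∑ i ∈ Finset.range m, v ^ i) *
      ((∑ i ∈ Finset.range l, (v ^ k) ^ i) ^ a - d * ∑ i ∈ Finset.range m, v ^ i) = 1 := by
  set S := ∑ i ∈ Finset.range m, v ^ i with hS
  have hvS : v * S = S := by
    have h := mul_geom_sum v m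
    rw [hv, sub_self, ← hS] at h
    linear_combination h
  have hviS : ∀ i, v ^ i * S = S := by
    intro i
    induction i with
    | zero => simp
    | succ i ih => rw [pow_succ, mul_assoc, hvS, ih]
  have hsS : ∀ n, (∑ i ∈ Finset.range n, v ^ i) * S = n * S := by
    intro n
    simp [Finset.sum_mul, hviS]
  have htS : (∑ i ∈ Finset.range l, (v ^ k) ^ i) * S = l * S := by
    simp [Finset.sum_mul, ← pow_mul, hviS]
  have hSS : S * S = m * S := hsS m
  have hst : (∑ i ∈ Finset.range k, v ^ i) * (∑ i ∈ Finset.range l, (v ^ k) ^ i) = 1 + S := by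
    have h : ∀ j, (∑ i ∈ Finset.range k, v ^ i) * (∑ i ∈ Finset.range j, (v ^ k) ^ i) =
        ∑ i ∈ Finset.range (k * j), v ^ i := by
      intro j
      induction j with
      | zero => simp
      | succ j ih =>
        rw [Finset.sum_range_succ, mul_add, ih, Nat.mul_succ, Finset.sum_range_add, Finset.sum_mul]
        congr 1
        refine Finset.sum_congr rfl fun i _ => ?_
        rw [← pow_mul, pow_add, mul_comm]
    rw [h, hkl, Finset.sum_range_add]
    simp [pow_add, ← Finset.mul_sum, hvS, ← hS]
  have powS : ∀ (x : R) (n : ℕ), x * S = n * S → ∀ b : ℕ, x ^ b * S = (n ^ b : ℕ) * S := by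
    intro x n hx b
    induction b with
    | zero => simp
    | succ b ih =>
      rw [pow_succ, mul_assoc, hx, mul_left_comm, ih]
      push_cast
      ring
  have hpow : ∀ b : ℕ, ∃ e : ℕ, (1 + m) ^ b = 1 + m * e ∧ (1 + S) ^ b = 1 + e * S := by
    intro b
    induction b with
    | zero => exact ⟨0, by simp, by simp⟩
    | succ b ih =>
      obtain ⟨e, h1, h2⟩ := ih
      refine ⟨e + 1 + m * e, by rw [pow_succ, h1]; ring, ?_⟩
      rw [pow_succ, h2]
      push_cast
      linear_combination (e : R) * hSS
  obtain ⟨e, he, he'⟩ := hpow a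
  -- The product to be computed expands to 1 + (e - c - d - mcd)S, so this identity makes it 1.
  have hce : e = c + d + m * c * d := by
    have h : m * e = m * (c + d + m * c * d) := by
      have : 1 + m * e = (1 + m * c) * (1 + m * d) := by
        rw [← he, ← hc, ← hd, ← mul_pow, hkl]
      linarith
    exact Nat.eq_of_mul_eq_mul_left hm h
  have h1 := powS _ _ (hsS k) a
  have h2 := powS _ _ htS a
  rw [hc] at h1
  rw [hd] at h2
  rw [← hst, mul_pow] at he'
  have hce' : (e : R) = c + d + m * c * d := by rw [hce]; push_cast; ring
  push_cast at h1 h2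
  rw [hce'] at he'
  linear_combination he' - (d : R) * h1 - (c : R) * h2 + (c * d : R) * hSS

/-- Otherwise Φ is coprime to f, so Φ(w) is invertible by Bézout; it kills w ^ p ^ j - 1, forcing w
^ p ^ j = 1. -/
theorem cyclotomic_dvd_of_aeval_eq_zero {R : Type*} [CommRing R] [Algebra ℚ R] {p j : ℕ}
    [Fact p.Prime] {w : R} (hw : w ^ p ^ (j + 1) = 1) (hw' : w ^ p ^ j ≠ 1) {f : ℚ[X]}
    (hf : aeval w f = 0) : cyclotomic (p ^ (j + 1)) ℚ ∣ f := by
  have hp : 0 < p ^ (j + 1) := pow_pos (Fact.out : p.Prime).pos _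
  by_contra hdvd
  obtain ⟨a, b, hab⟩ := ((cyclotomic.irreducible_rat hp).coprime_iff_not_dvd).2 hdvd
  apply hw'
  have h := congrArg (aeval w) (cyclotomic_prime_pow_mul_X_pow_sub_one ℚ p j)
  have h' := congrArg (aeval w) hab
  simp only [map_mul, map_sub, map_add, map_pow, aeval_X, map_one, hf, hw, mul_zero, add_zero,
    sub_self] at h h'
  linear_combination (aeval w a) * h - (w ^ p ^ j - 1) * h'

theorem one_lt_norm_of_one_lt_re {z : ℂ} (h : 1 < z.re) : 1 < ‖z‖ :=
  h.trans_le (Complex.re_le_norm z)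

/-- For `m = 8` or `m ≥ 5` odd, some partial geometric sum of `exp (2πi / m)`, of length dividing
`1 + m`, has absolute value greater than one. -/
theorem exists_one_lt_norm_geom_sum {m : ℕ} (hm : m = 8 ∨ (Odd m ∧ 5 ≤ m)) :
    ∃ k l : ℕ, k * l = 1 + m ∧
      1 < ‖∑ i ∈ Finset.range k, Complex.exp (2 * Real.pi * Complex.I / m) ^ i‖ := by
  rcases hm with rfl | ⟨⟨l, rfl⟩, h5⟩
  · refine ⟨3, 3, rfl, one_lt_norm_of_one_lt_re ?_⟩
    have h1 : Complex.exp (2 * Real.pi * Complex.I / (8 : ℕ)) =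
        Complex.exp ((Real.pi / 4 : ℝ) * Complex.I) := by
      congr 1; push_cast; ring
    have h2 : Complex.exp (2 * Real.pi * Complex.I / (8 : ℕ)) ^ 2 =
        Complex.exp ((Real.pi / 2 : ℝ) * Complex.I) := by
      rw [← Complex.exp_nat_mul]
      congr 1; push_cast; ring
    simp only [Finset.sum_range_succ, Finset.sum_range_zero, pow_zero, pow_one, zero_add,
      Complex.add_re, h2]
    rw [h1, Complex.exp_ofReal_mul_I_re, Complex.exp_ofReal_mul_I_re, Real.cos_pi_div_four,
      Real.cos_pi_div_two, Complex.one_re]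
    have : 0 < √(2 : ℝ) := by positivity
    linarith
  · refine ⟨2, l + 1, by ring, one_lt_norm_of_one_lt_re ?_⟩
    have h1 : Complex.exp (2 * Real.pi * Complex.I / (2 * l + 1 : ℕ)) =
        Complex.exp ((2 * Real.pi / (2 * l + 1 : ℕ) : ℝ) * Complex.I) := by
      congr 1; push_cast; ring
    have h5' : (5 : ℝ) ≤ (2 * l + 1 : ℕ) := by exact_mod_cast h5
    have hpi := Real.pi_pos
    have hlt : 2 * Real.pi / (2 * l + 1 : ℕ) < Real.pi / 2 := by
      rw [div_lt_iff₀ (by linarith)]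
      nlinarith
    have hcos : 0 < Real.cos (2 * Real.pi / (2 * l + 1 : ℕ)) :=
      Real.cos_pos_of_mem_Ioo ⟨by linarith [show 0 ≤ 2 * Real.pi / (2 * l + 1 : ℕ) by positivity],
        hlt⟩
    simp only [Finset.sum_range_succ, Finset.sum_range_zero, pow_zero, pow_one, zero_add,
      Complex.add_re]
    rw [h1, Complex.exp_ofReal_mul_I_re, Complex.one_re]
    linarith

/-- In a torsion-free ring with finitely many units there are no roots of unity whose order
is a prime power not dividing `12`. -/
theorem pow_eq_one_of_finite_units {R : Type*} [CommRing R] [Module.IsTorsionFree ℤ R] [Finite Rˣ]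
    {p j : ℕ} (hp : p.Prime) (hm : p ^ (j + 1) = 8 ∨ (Odd (p ^ (j + 1)) ∧ 5 ≤ p ^ (j + 1)))
    {w : R} (hw : w ^ p ^ (j + 1) = 1) : w ^ p ^ j = 1 := by
  have := Fact.mk hp
  by_contra hw'
  set m := p ^ (j + 1) with hmdef
  have hm0 : 0 < m := pow_pos hp.pos _
  obtain ⟨k, l, hkl, hnorm⟩ := exists_one_lt_norm_geom_sum hm
  -- Euler's theorem, as x is prime to m, supplies the constants c and d of the Bass unit.
  have hcop : ∀ x : ℕ, x ∣ 1 + m → ∃ c, x ^ m.totient = 1 + m * c := by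
    intro x hx
    have hx1 : Nat.Coprime x m := by
      refine Nat.Coprime.coprime_dvd_left hx ?_
      simp
    have hmod := (Nat.ModEq.pow_totient hx1).symm
    have hpos : 1 ≤ x ^ m.totient := Nat.one_le_pow _ _ (Nat.pos_of_dvd_of_pos hx (by omega))
    obtain ⟨c, hc⟩ := (Nat.modEq_iff_dvd' hpos).1 hmod
    exact ⟨c, by omega⟩
  obtain ⟨c, hc⟩ := hcop k ⟨l, hkl.symm⟩
  obtain ⟨d, hd⟩ := hcop l ⟨k, by rw [mul_comm, hkl]⟩
  set a := m.totient with ha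
  have ha0 : a ≠ 0 := (Nat.totient_pos.2 hm0).ne'
  have hunit := bass_cyclic_mul_eq_one hm0 hw hkl hc hd
  obtain ⟨N, hN, hpow⟩ : ∃ N : ℕ, N ≠ 0 ∧
      ((∑ i ∈ Finset.range k, w ^ i) ^ a - c * ∑ i ∈ Finset.range m, w ^ i) ^ N = 1 := by
    refine ⟨Nat.card Rˣ, Nat.card_pos.ne', ?_⟩
    have h := pow_card_eq_one' (x := Units.mkOfMulEqOne _ _ hunit)
    exact (congrArg Units.val h :)
  let f : ℚ[X] := ((∑ i ∈ Finset.range k, X ^ i) ^ a -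
    (c : ℚ[X]) * ∑ i ∈ Finset.range m, X ^ i) ^ N - 1
  -- Torsion-freeness lets R embed in a ℚ-algebra, where Φ_m is irreducible and w can be traded for
  -- ζ.
  have hinj : Function.Injective
      (Algebra.TensorProduct.includeRight : R →ₐ[ℤ] TensorProduct ℤ ℚ R) :=
    Algebra.TensorProduct.includeRight_injective (algebraMap ℤ ℚ).injective_int
  set φ := (Algebra.TensorProduct.includeRight : R →ₐ[ℤ] TensorProduct ℤ ℚ R)
  have hdvd : cyclotomic m ℚ ∣ f := by
    refine cyclotomic_dvd_of_aeval_eq_zero (R := TensorProduct ℤ ℚ R) (w := φ w) ?_ ?_ ?_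
    · rw [← map_pow, ← hmdef, hw, map_one]
    · rw [← map_pow]
      exact fun h => hw' (hinj (h.trans (map_one φ).symm))
    · simpa [f, sub_eq_zero] using congrArg φ hpow
  have hprim := Complex.isPrimitiveRoot_exp m hm0.ne'
  set ζ := Complex.exp (2 * Real.pi * Complex.I / m)
  have hm1 : 1 < m := by rcases hm with h | h <;> omega
  have hfζ : aeval ζ f = 0 := by
    obtain ⟨g, hg⟩ := hdvd
    have : aeval ζ (cyclotomic m ℚ) = 0 := by
      rw [aeval_def, ← eval_map, map_cyclotomic]
      exact (hprim.isRoot_cyclotomic hm0)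
    rw [hg, map_mul, this, zero_mul]
  -- The full sum of length m vanishes at ζ, so the correction term drops out and a number of norm >
  -- 1 becomes a root of unity.
  have hone : (∑ i ∈ Finset.range k, ζ ^ i) ^ (a * N) = 1 := by
    simpa [f, sub_eq_zero, hprim.geom_sum_eq_zero hm1, ← pow_mul] using hfζ
  have := congrArg norm hone
  rw [norm_pow, norm_one] at this
  exact (one_lt_pow₀ hnorm (mul_ne_zero ha0 hN)).ne' this

/-- The least prime powers not dividing 12 are 8, 9 and p for each prime p ≥ 5. -/
theorem exists_prime_pow_dvd_of_not_dvd_twelve {n : ℕ} (hn : 0 < n) (h : ¬ n ∣ 12) :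
    ∃ p j : ℕ, p.Prime ∧ (p ^ (j + 1) = 8 ∨ (Odd (p ^ (j + 1)) ∧ 5 ≤ p ^ (j + 1))) ∧
      p ^ (j + 1) ∣ n := by
  by_contra! hcon
  apply h
  rw [← Nat.factorization_prime_le_iff_dvd hn.ne' (by norm_num)]
  intro p hp
  rw [← hp.pow_dvd_iff_le_factorization (by norm_num)]
  by_contra hlt
  have hdvd := Nat.ordProj_dvd n p
  generalize n.factorization p = e at hlt hdvd
  have key : ∀ j, (p ^ (j + 1) = 8 ∨ (Odd (p ^ (j + 1)) ∧ 5 ≤ p ^ (j + 1))) → e < j + 1 := by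
    intro j hj
    by_contra! hle
    exact hcon p j hp hj ((pow_dvd_pow p hle).trans hdvd)
  have hne : e ≠ 0 := by rintro rfl; exact hlt (by simp)
  rcases hp.eq_two_or_odd' with rfl | hodd
  · have := key 2 (by norm_num)
    interval_cases e <;> first | exact hne rfl | norm_num at hlt
  · by_cases h3 : p = 3
    · subst h3
      have := key 1 (by norm_num)
      interval_cases e <;> first | exact hne rfl | norm_num at hlt
    · have h2 := hp.two_le
      have h5 : 5 ≤ p := by
        obtain ⟨r, rfl⟩ := hodd
        omega
      have := key 0 (.inr (by simpa using ⟨hodd, h5⟩))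
      omega

theorem units_pow_twelve {R : Type*} [CommRing R] [Module.IsTorsionFree ℤ R] [Finite Rˣ]
    (x : Rˣ) : x ^ 12 = 1 := by
  rw [← orderOf_dvd_iff_pow_eq_one]
  by_contra h
  obtain ⟨p, j, hp, hm, r, hr⟩ := exists_prime_pow_dvd_of_not_dvd_twelve (orderOf_pos x) h
  have h1 : ((x ^ r : Rˣ) : R) ^ p ^ (j + 1) = 1 := by
    rw [← Units.val_pow_eq_pow_val, ← pow_mul, mul_comm, ← hr, pow_orderOf_eq_one, Units.val_one]
  have h2 := pow_eq_one_of_finite_units hp hm h1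
  rw [← Units.val_pow_eq_pow_val, Units.val_eq_one, ← pow_mul] at h2
  have h3 := orderOf_dvd_of_pow_eq_one h2
  rw [hr] at h3
  have hr0 : 0 < r := by
    rcases Nat.eq_zero_or_pos r with rfl | h0
    · exact absurd (orderOf_pos x) (by simp [hr])
    · exact h0
  rw [mul_comm] at h3
  have := (Nat.pow_dvd_pow_iff_le_right hp.one_lt).1 (Nat.dvd_of_mul_dvd_mul_left hr0 h3)
  omega

/-! ### Splitting off the torsion by an idempotent -/

/-- In a reduced ring, a finite ideal is generated by an idempotent. -/
theorem exists_isIdempotentElem_span_eq_of_finite {R : Type*} [CommRing R] [IsReduced R]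
    (I : Ideal R) [Finite I] : ∃ e : R, IsIdempotentElem e ∧ I = Ideal.span {e} := by
  obtain ⟨k, hk0, hk⟩ : ∃ k, k ≠ 0 ∧ IsIdempotentElem (I ^ k) := by
    have hfin : (Set.range fun k : ℕ => I ^ (k + 1)).Finite := by
      have : (Set.Iic I).Finite := by
        refine Set.Finite.of_finite_image (f := ((↑) : Ideal R → Set R)) ?_
          SetLike.coe_injective.injOn
        refine (Set.toFinite (I : Set R)).finite_subsets.subset ?_
        rintro _ ⟨J, hJ, rfl⟩
        exact hJ
      refine this.subset ?_
      rintro _ ⟨k, rfl⟩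
      exact Ideal.pow_le_self k.succ_ne_zero
    obtain ⟨a, b, hab, h⟩ : ∃ a b : ℕ, a < b ∧ I ^ (a + 1) = I ^ (b + 1) := by
      by_contra! hcon
      refine Set.infinite_range_of_injective (f := fun k : ℕ => I ^ (k + 1)) ?_ hfin
      intro a b hab
      rcases lt_trichotomy a b with h | h | h
      · exact (hcon a b h hab).elim
      · exact h
      · exact (hcon b a h hab.symm).elim
    have hstep : ∀ n, a + 1 ≤ n → I ^ n ≤ I ^ (n + 1) := by
      intro n hn
      obtain ⟨t, rfl⟩ := Nat.exists_eq_add_of_le hn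
      rw [pow_add, h, ← pow_add]
      exact Ideal.pow_le_pow_right (by omega)
    have hle : ∀ t, I ^ (a + 1) ≤ I ^ (a + 1 + t) := by
      intro t
      induction t with
      | zero => exact le_rfl
      | succ t ih => exact ih.trans (hstep _ (by omega))
    refine ⟨a + 1, by omega, ?_⟩
    refine le_antisymm Ideal.mul_le_left ?_
    rw [← pow_add]
    exact hle _
  have : Finite (I ^ k : Ideal R) := Finite.Set.subset (I : Set R) (Ideal.pow_le_self hk0)
  have hfg : (I ^ k).FG := Module.Finite.iff_fg.1 (Module.Finite.of_finite)
  obtain ⟨e, he, hIe⟩ := (Ideal.isIdempotentElem_iff_of_fg _ hfg).1 hk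
  refine ⟨e, he, le_antisymm ?_ ?_⟩
  · intro x hx
    have h1 : x ^ k ∈ Ideal.span {e} := by
      have := Ideal.pow_mem_pow hx k
      rwa [hIe] at this
    obtain ⟨y, hy⟩ := Ideal.mem_span_singleton'.1 h1
    -- x ^ k is a multiple of e, so x(1 - e) is nilpotent, hence zero.
    have h2 : (x * (1 - e)) ^ k = 0 := by
      obtain ⟨t, rfl⟩ := Nat.exists_eq_succ_of_ne_zero hk0
      rw [mul_pow, ← hy, pow_succ]
      linear_combination (-(y * (1 - e) ^ t)) * he.eq
    have h3 := pow_eq_zero_iff hk0 |>.1 h2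
    exact Ideal.mem_span_singleton'.2 ⟨x, by linear_combination -h3⟩
  · refine le_trans (le_of_eq hIe.symm) (Ideal.pow_le_self hk0)

theorem isReduced_quotient_span_idempotent {R : Type*} [CommRing R] [IsReduced R] {e : R}
    (he : IsIdempotentElem e) : IsReduced (R ⧸ Ideal.span {e}) := by
  refine ⟨fun x hx => ?_⟩
  obtain ⟨x, rfl⟩ := Ideal.Quotient.mk_surjective x
  obtain ⟨n, hn⟩ := hx
  have hn' : Ideal.Quotient.mk (Ideal.span {e}) (x ^ (n + 1)) = 0 := by
    rw [map_pow, pow_succ, hn, zero_mul]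
  rw [Ideal.Quotient.eq_zero_iff_mem] at hn' ⊢
  obtain ⟨y, hy⟩ := Ideal.mem_span_singleton'.1 hn'
  have h2 : (x * (1 - e)) ^ (n + 1) = 0 := by
    rw [mul_pow, ← hy, pow_succ]
    linear_combination (-(y * (1 - e) ^ n)) * he.eq
  have h3 := (pow_eq_zero_iff n.succ_ne_zero).1 h2
  exact Ideal.mem_span_singleton'.2 ⟨x, by linear_combination -h3⟩

/-- The ring isomorphism `R ≃ R / e × R / (1 - e)` for an idempotent `e`. -/
noncomputable def IsIdempotentElem.quotientProdEquiv {R : Type*} [CommRing R] {e : R}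
    (he : IsIdempotentElem e) :
    R ≃+* (R ⧸ Ideal.span {e}) × (R ⧸ Ideal.span {1 - e}) :=
  ((RingEquiv.quotientBot R).symm.trans (Ideal.quotEquivOfEq (by
    rw [Ideal.span_singleton_mul_span_singleton, mul_sub, mul_one, he.eq, sub_self,
      Ideal.span_singleton_eq_bot.2 rfl]))).trans
    (Ideal.quotientMulEquivQuotientProd _ _ (Ideal.isCoprime_span_singleton_iff _ _ |>.2
      ⟨1, 1, by ring⟩))

theorem isProdFiniteFieldUnits_units_of_module_finite (R : Type u) [CommRing R] [IsReduced R]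
    [Module.Finite ℤ R] [Finite Rˣ] : IsProdFiniteFieldUnits Rˣ := by
  let T : Ideal R := Submodule.torsion' R R (nonZeroDivisors ℤ)
  have hT : ∀ x, x ∈ T ↔ ∃ a : ℤ, a ≠ 0 ∧ a • x = 0 := by
    intro x
    rw [Submodule.mem_torsion'_iff]
    constructor
    · rintro ⟨a, ha⟩
      exact ⟨a, nonZeroDivisors.ne_zero a.2, ha⟩
    · rintro ⟨a, h0, ha⟩
      exact ⟨⟨a, mem_nonZeroDivisors_of_ne_zero h0⟩, ha⟩
  have : IsNoetherian ℤ R := inferInstance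
  have : Finite T := by
    have : Module.Finite ℤ (T.restrictScalars ℤ) := inferInstance
    refine Module.finite_of_fg_torsion (T.restrictScalars ℤ) ?_
    rintro ⟨x, hx⟩
    obtain ⟨a, h0, ha⟩ := (hT x).1 hx
    exact ⟨⟨a, mem_nonZeroDivisors_of_ne_zero h0⟩, Subtype.ext ha⟩
  obtain ⟨e, he, hTe⟩ := exists_isIdempotentElem_span_eq_of_finite T
  let φ := he.quotientProdEquiv
  let ψ := (Units.mapEquiv φ.toMulEquiv).trans MulEquiv.prodUnits
  have := isReduced_quotient_span_idempotent he.one_sub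
  have : Finite (R ⧸ Ideal.span {1 - e}) := by
    refine Finite.of_surjective (fun x : T => Ideal.Quotient.mk (Ideal.span {1 - e}) x) ?_
    intro y
    obtain ⟨y, rfl⟩ := Ideal.Quotient.mk_surjective y
    refine ⟨⟨y * e, hTe ▸ Ideal.mem_span_singleton'.2 ⟨y, rfl⟩⟩, ?_⟩
    exact Ideal.Quotient.eq.2 (Ideal.mem_span_singleton'.2 ⟨-y, by ring⟩)
  have : Finite (R ⧸ Ideal.span {e})ˣ :=
    Finite.of_surjective (fun u => (ψ u).1) (Prod.fst_surjective.comp ψ.surjective)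
  have : Module.IsTorsionFree ℤ (R ⧸ Ideal.span {e}) := by
    rw [Module.isTorsionFree_iff_smul_eq_zero]
    intro a x hax
    by_contra! hcon
    obtain ⟨x, rfl⟩ := Ideal.Quotient.mk_surjective x
    have h1 : a • x ∈ T := by
      rw [hTe, ← Ideal.Quotient.eq_zero_iff_mem, map_zsmul]
      exact hax
    obtain ⟨b, hb0, hb⟩ := (hT _).1 h1
    refine hcon.2 (Ideal.Quotient.eq_zero_iff_mem.2 ?_)
    rw [← hTe, hT]
    exact ⟨b * a, mul_ne_zero hb0 hcon.1, by rw [mul_smul, hb]⟩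
  exact ((IsProdFiniteFieldUnits.of_pow_twelve units_pow_twelve).prod
    (isProdFiniteFieldUnits_units_of_finite _)).of_mulEquiv ψ

/-! ### Reduction to the subring generated by the units -/

open scoped IsMulCommutative in
theorem isProdFiniteFieldUnits_units (A : Type u) [Ring A] [IsReduced A] [Finite Aˣ]
    (hcomm : ∀ x y : Aˣ, x * y = y * x) : IsProdFiniteFieldUnits Aˣ := by
  let s : Set A := Set.range ((↑) : Aˣ → A)
  obtain ⟨B, hB⟩ : ∃ B, B = Algebra.adjoin ℤ s := ⟨_, rfl⟩
  have hs : IsMulCommutative B := hB ▸ Algebra.isMulCommutative_adjoin ℤ (by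
    rintro _ ⟨x, rfl⟩ _ ⟨y, rfl⟩
    exact congrArg Units.val (hcomm x y))
  have : IsReduced B := isReduced_of_injective B.val Subtype.val_injective
  have : Module.Finite ℤ B := by
    have htop : Algebra.adjoin ℤ (((↑) : B → A) ⁻¹' s) = ⊤ := by
      subst hB
      exact Algebra.adjoin_adjoin_coe_preimage
    have hfin : (((↑) : B → A) ⁻¹' s).Finite :=
      (Set.finite_range _).preimage Subtype.val_injective.injOn
    -- Units have finite order, so the finitely many generators are integral over ℤ.
    have hint : ∀ x ∈ (((↑) : B → A) ⁻¹' s), IsIntegral ℤ x := by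
      rintro x ⟨y, hy⟩
      refine IsIntegral.of_pow (n := Nat.card Aˣ) Nat.card_pos ?_
      have : x ^ Nat.card Aˣ = 1 := by
        apply Subtype.val_injective
        have h : (y : A) ^ Nat.card Aˣ = 1 := congrArg Units.val (pow_card_eq_one' (x := y))
        rwa [hy] at h
      rw [this]
      exact isIntegral_one
    have := fg_adjoin_of_finite hfin hint
    rw [htop, Algebra.top_toSubmodule] at this
    exact ⟨this⟩
  have hmem : ∀ x : Aˣ, (x : A) ∈ B := fun x => hB ▸ Algebra.subset_adjoin ⟨x, rfl⟩
  let e : Bˣ ≃* Aˣ := MulEquiv.ofBijective (Units.map (B.val : B →* A)) (by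
    refine ⟨Units.map_injective Subtype.val_injective, fun x => ?_⟩
    exact ⟨⟨⟨x, hmem x⟩, ⟨_, hmem x⁻¹⟩, Subtype.ext x.mul_inv, Subtype.ext x.inv_mul⟩,
      Units.ext rfl⟩)
  have : Finite Bˣ := Finite.of_equiv _ e.symm.toEquiv
  exact (isProdFiniteFieldUnits_units_of_module_finite B).of_mulEquiv e.symm

theorem isReducedUnitForm_of_units_mulEquiv {G : Type u} [CommGroup G] [Finite G] {A : Type v}
    [Ring A] [IsReduced A] (e : Aˣ ≃* G) : IsReducedUnitForm G := by
  have : Finite Aˣ := Finite.of_equiv _ e.symm.toEquiv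
  exact ((isProdFiniteFieldUnits_units A fun x y => e.injective (by
    rw [map_mul, map_mul, mul_comm])).of_mulEquiv e.symm).isReducedUnitForm

/-- The finite abelian groups that are the unit group of a reduced ring; first for commutative
rings, then for rings that need not be commutative (without nonzero nilpotent elements). -/
theorem corollary5p19 (G : Type u) [CommGroup G] [Finite G] :
    ((∃ (A : Type v) (_ : CommRing A), IsReduced A ∧ Nonempty (Aˣ ≃* G)) ↔
      IsReducedUnitForm G) ∧
    ((∃ (A : Type v) (_ : Ring A), IsReduced A ∧ Nonempty (Aˣ ≃* G)) ↔
      IsReducedUnitForm G) := by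
  refine ⟨⟨?_, fun h => (isReducedUnitForm_iff.1 h).exists_commRing⟩, ⟨?_, fun h => ?_⟩⟩
  · rintro ⟨A, _, _, ⟨e⟩⟩
    exact isReducedUnitForm_of_units_mulEquiv e
  · rintro ⟨A, _, _, ⟨e⟩⟩
    exact isReducedUnitForm_of_units_mulEquiv e
  · obtain ⟨A, _, hA, e⟩ := (isReducedUnitForm_iff.1 h).exists_commRing
    exact ⟨A, inferInstance, hA, e⟩
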